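/- **Theorem (Condition for IBR).** *Domain.* Let $d\in\{2,3\}$ and $V\in\mathbb R^{3\times 3}$; if $d=2$, assume that every column of $V$ is a multiple of $\mathbf e_3$. Vectors of $\mathbb R^2$ are padded by a zero third entry. Let $[x]_\times$ be the matrix of $y\mapsto x\times y$, and let the agent domain $\mathcal D\subseteq SE(3)=\mathbb R^3\times SO(3)$ consist of the pairs $(p,R)$ with $p\in\mathbb R^d$ and $R$ a product of rotations of the form $\exp([Vx]_\times)$, $x\in\mathbb R^3$. Each agent has $c=d+\operatorname{rank}V\le 6$ controllable degrees of freedom: $d$ translational ones and $\operatorname{rank} V$ rotational ones, about the directions in the column space of $V$. (For example: $V=0$ gives $\mathbb R^d$; $V=[0\;0\;\mathbf e_3]$ with $d=2$ gives $\mathbb R^2\times\mathbb S^1$; $V=[0\;0\;\mathbf n]$ with $d=3$ and a unit vector $\mathbf n$ gives $\mathbb R^3\times\mathbb S^1$; $V=I_3$ with $d=3$ gives $SE(3)$.) *Framework.* Let $n\ge 3$, and let $(\mathcal G,\chi)$ be a homogeneous framework in $\mathcal D^n$: a configuration $\chi=((p_i,R_i))_{i=1}^n\in\mathcal D^n$ and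 a loopless graph $\mathcal G$ on $n$ vertices, which is either directed or undirected with an arbitrary orientation, and which is directed if $V\ne0$. Let $\mathcal K$ be the associated complete graph: both edges between any two distinct vertices if $\mathcal G$ is directed, and exactly one oriented edge between any two distinct vertices, extending the orientation of $\mathcal G$, if $\mathcal G$ is undirected. Assume that the framework is non-degenerate: the positions $p_1,\dots,p_n$ are pairwise distinct and not all collinear. *Rigidity matrix.* For a graph with $m$ oriented edges $e_k=(v_i,v_j)$, let $E\in\mathbb R^{n\times m}$ be the incidence matrix ($-1$ at the first vertex $v_i$ and $+1$ at the second vertex $v_j$ of $e_k$), let $E_o$ keep only its entries $-1$, and let $\bar E=E\otimes I_3$, $\bar E_o=E_o\otimes I_3$. Put $p_{ij}=p_j-p_i$, $d_{ij}=\|p_{ij}\|^{-1}$, $\bar p_{ij}=d_{ij}p_{ij}$, and $P(\bar p_{ij})=I_d-\bar p_{ij}\bar p_{ij}^\top$, padded by zeros to a $3\times3$ matrix if $d=2$. The bearing rigidity matrix is $$B=\big[\,D_p\bar E^\top\;\; D_o\bar E_o^\top\,\big]\in\mathbb R^{3m\times 6n},\qquad D_p=\operatorname{diag}\big(d_{ij}R_i^\top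 P(\bar p_{ij})\big),\quad D_o=-\operatorname{diag}\big(R_i^\top[\bar p_{ij}]_\times V\big),$$ with one diagonal block for each edge. Write $B_{\mathcal G}(\chi)$ and $B_{\mathcal K}(\chi)$ for this matrix for $\mathcal G$ and $\mathcal K$. The framework is infinitesimally bearing rigid (IBR) if $\ker B_{\mathcal G}(\chi)=\ker B_{\mathcal K}(\chi)$. *Claim.* The framework $(\mathcal G,\chi)$ is infinitesimally bearing rigid if and only if $\operatorname{rank}B_{\mathcal G}(\chi)=cn-c-1$. -/

import Mathlib

open scoped Matrix Kronecker

noncomputable section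

namespace BearingRigidity

/-- The skew-symmetric matrix of `x`, i.e. the matrix of the map `y ↦ x × y`. -/
def skew (x : Fin 3 → ℝ) : Matrix (Fin 3) (Fin 3) ℝ :=
  LinearMap.toMatrix' (crossProduct x)

/-- The Euclidean norm on `ℝ³` (`Fin 3 → ℝ` carries the sup norm in Mathlib). -/
def enorm3 (x : Fin 3 → ℝ) : ℝ := Real.sqrt (x ⬝ᵥ x)

/-- The special orthogonal group `SO(3)`. -/
abbrev SO3 : Type := Matrix.specialOrthogonalGroup (Fin 3) ℝ

/-- The data of a (homogeneous) agent domain `𝒟 ⊆ SE(3) = ℝ³ × SO(3)`.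

`d` is the number of translational degrees of freedom: `d = 3` means that the agents move in space,
`d = 2` that they move in the plane spanned by the first two vectors of the canonical basis.
The columns of the constant matrix `V` span the directions (in the world frame) about which
an agent is able to rotate. The agents of a planar domain can only rotate within their plane.

* `ℝ²`: `d = 2`, `V = 0`;                      `ℝ³`: `d = 3`, `V = 0`;
* `ℝ² × 𝕊¹`: `d = 2`, `V = [0 0 e₃]`;          `ℝ³ × 𝕊¹`: `d = 3`, `V = [0 0 n]`, `n` a unit vector;
* `SE(3)`: `d = 3`, `V = I₃`. -/
structure AgentDomain where
  d : ℕ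
  d_eq : d = 2 ∨ d = 3
  V : Matrix (Fin 3) (Fin 3) ℝ
  planar_axis : d = 2 → ∀ k, V 0 k = 0 ∧ V 1 k = 0

namespace AgentDomain

/-- The number `c` of controllable degrees of freedom of an agent: `d` translational ones and
`rank V` rotational ones (so that `c ≤ 6`). -/
def dofs (D : AgentDomain) : ℕ := D.d + D.V.rank

/-- The rotations which an agent can reach: products of rotations about the directions in the
column space of `V`. This is `{I₃}` for `V = 0`, the group of rotations about `n` for
`V = [0 0 n]`, and all of `SO(3)` for `V = I₃`. -/
def rotations (D : AgentDomain) : Submonoid (Matrix (Fin 3) (Fin 3) ℝ) :=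
  Submonoid.closure (Set.range fun x : Fin 3 → ℝ => NormedSpace.exp (skew (D.V *ᵥ x)))

/-- The domain `𝒟` as a subset of `SE(3) = ℝ³ × SO(3)`. A planar position is padded by a zero. -/
def poses (D : AgentDomain) : Set ((Fin 3 → ℝ) × SO3) :=
  {q | (D.d = 2 → q.1 2 = 0) ∧ (q.2 : Matrix (Fin 3) (Fin 3) ℝ) ∈ D.rotations}

/-- The identity of `ℝᵈ`, as a `3 × 3` matrix padded by zeros. -/
def idBlock (D : AgentDomain) : Matrix (Fin 3) (Fin 3) ℝ :=
  Matrix.diagonal fun i => if (i : ℕ) < D.d then 1 else 0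

/-- The orthogonal projector `P(x) = I_d - (x/‖x‖)(x/‖x‖)ᵀ` for `x ∈ ℝᵈ`, as a `3 × 3` matrix:
for `d = 2` its upper left `2 × 2` block is the projector, and its other entries are zero. -/
def proj (D : AgentDomain) (x : Fin 3 → ℝ) : Matrix (Fin 3) (Fin 3) ℝ :=
  D.idBlock - Matrix.vecMulVec ((enorm3 x)⁻¹ • x) ((enorm3 x)⁻¹ • x)

end AgentDomain

/-- A sensing graph on the vertices `v_1, …, v_n`: either a directed graph (`directed = true`), or
an undirected graph together with an arbitrary orientation (`directed = false`). The edge `(i, j)`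
stands for the bearing of agent `j` measured by agent `i`. -/
structure SensingGraph (n : ℕ) where
  edges : Finset (Fin n × Fin n)
  directed : Bool
  irrefl : ∀ i j, (i, j) ∈ edges → i ≠ j
  oriented : directed = false → ∀ i j, (i, j) ∈ edges → (j, i) ∉ edges

namespace SensingGraph

variable {n : ℕ}

/-- The complete graph associated to `G`. If `G` is directed, it has both edges between any two
distinct vertices. If `G` is undirected, it has one (oriented) edge for any two distinct vertices:
the one of `G` if there is one, and the one from the smaller to the larger index otherwise. -/
def complete (G : SensingGraph n) : SensingGraph n where
  edges := Finset.univ.filter fun e =>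
    e.1 ≠ e.2 ∧ (G.directed = true ∨ e ∈ G.edges ∨ (e.1 < e.2 ∧ (e.2, e.1) ∉ G.edges))
  directed := G.directed
  irrefl := by
    intro i j h
    exact (Finset.mem_filter.mp h).2.1
  oriented := by
    intro hd i j h h'
    have h1 := (Finset.mem_filter.mp h).2.2
    have h2 := (Finset.mem_filter.mp h').2.2
    have h3 := G.oriented hd i j
    rcases h1 with h1 | h1 | ⟨h1, h1'⟩
    · simp [hd] at h1
    · rcases h2 with h2 | h2 | ⟨h2, h2'⟩
      · simp [hd] at h2
      · exact h3 h1 h2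
      · exact h2' h1
    · rcases h2 with h2 | h2 | ⟨h2, h2'⟩
      · simp [hd] at h2
      · exact h1' h2
      · exact absurd h1 (not_lt.mpr h2.le)

/-- The incidence matrix `E`. -/
def incidence (G : SensingGraph n) : Matrix (Fin n) G.edges ℝ :=
  Matrix.of fun i k => if k.1.1 = i then -1 else if k.1.2 = i then 1 else 0

/-- The matrix `E_o`, which keeps the outgoing part of the incidence matrix. -/
def incidenceOut (G : SensingGraph n) : Matrix (Fin n) G.edges ℝ :=
  Matrix.of fun i k => if k.1.1 = i then -1 else 0

/-- The matrix `E ⊗ I₃`. -/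
def incidenceBar (G : SensingGraph n) : Matrix (Fin n × Fin 3) (G.edges × Fin 3) ℝ :=
  G.incidence ⊗ₖ (1 : Matrix (Fin 3) (Fin 3) ℝ)

/-- The matrix `E_o ⊗ I₃`. -/
def incidenceOutBar (G : SensingGraph n) : Matrix (Fin n × Fin 3) (G.edges × Fin 3) ℝ :=
  G.incidenceOut ⊗ₖ (1 : Matrix (Fin 3) (Fin 3) ℝ)

/-- The block diagonal matrix with the blocks `M k`, one for each edge `k`. -/
def blockDiag (G : SensingGraph n) (M : G.edges → Matrix (Fin 3) (Fin 3) ℝ) :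
    Matrix (G.edges × Fin 3) (G.edges × Fin 3) ℝ :=
  (Matrix.blockDiagonal M).submatrix Prod.swap Prod.swap

end SensingGraph

/-- A configuration `χ ∈ 𝒟ⁿ`: agent `i` has position `p i` and orientation `R i`. -/
structure Configuration (D : AgentDomain) (n : ℕ) where
  p : Fin n → Fin 3 → ℝ
  R : Fin n → SO3
  mem : ∀ i, (p i, R i) ∈ D.poses

namespace Configuration

variable {D : AgentDomain} {n : ℕ}

/-- The relative position `p_ij = p_j - p_i`. -/
def rel (χ : Configuration D n) (i j : Fin n) : Fin 3 → ℝ := χ.p j - χ.p i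

/-- The reciprocal distance `d_ij = ‖p_ij‖⁻¹`. -/
def invDist (χ : Configuration D n) (i j : Fin n) : ℝ := (enorm3 (χ.rel i j))⁻¹

/-- The normalized relative position `p̄_ij = d_ij p_ij`. -/
def dir (χ : Configuration D n) (i j : Fin n) : Fin 3 → ℝ := χ.invDist i j • χ.rel i j

/-- The matrix `D_p = diag (d_ij R_iᵀ P(p̄_ij))`. -/
def Dp (χ : Configuration D n) (G : SensingGraph n) :
    Matrix (G.edges × Fin 3) (G.edges × Fin 3) ℝ :=
  G.blockDiag fun k => χ.invDist k.1.1 k.1.2 •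
    ((χ.R k.1.1 : Matrix (Fin 3) (Fin 3) ℝ)ᵀ * D.proj (χ.dir k.1.1 k.1.2))

/-- The matrix `D_o = -diag (R_iᵀ [p̄_ij]ₓ V)`. -/
def Do (χ : Configuration D n) (G : SensingGraph n) :
    Matrix (G.edges × Fin 3) (G.edges × Fin 3) ℝ :=
  -G.blockDiag fun k =>
    (χ.R k.1.1 : Matrix (Fin 3) (Fin 3) ℝ)ᵀ * skew (χ.dir k.1.1 k.1.2) * D.V

/-- The bearing rigidity matrix `B = [D_p (E ⊗ I₃)ᵀ  D_o (E_o ⊗ I₃)ᵀ]`, with `3m` rows and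
`6n` columns. -/
def bearingRigidityMatrix (χ : Configuration D n) (G : SensingGraph n) :
    Matrix (G.edges × Fin 3) ((Fin n × Fin 3) ⊕ (Fin n × Fin 3)) ℝ :=
  Matrix.fromCols (χ.Dp G * G.incidenceBarᵀ) (χ.Do G * G.incidenceOutBarᵀ)

end Configuration

/-- A framework `(G, χ)` in `𝒟ⁿ`. Bearings measured by agents which can rotate are expressed in
their local frames and are not reciprocal, so the graph is then directed. -/
structure Framework (D : AgentDomain) (n : ℕ) where
  G : SensingGraph n
  χ : Configuration D n
  directed_of_rotating : D.V ≠ 0 → G.directed = true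

namespace Framework

variable {D : AgentDomain} {n : ℕ}

/-- The agents are not all collinear, and no two of them have the same position. -/
def NonDegenerate (F : Framework D n) : Prop :=
  ¬ Collinear ℝ (Set.range F.χ.p) ∧ Function.Injective F.χ.p

/-- Infinitesimal bearing rigidity: `ker B_G(χ) = ker B_K(χ)`, with `K` the complete graph. -/
def IsIBR (F : Framework D n) : Prop :=
  LinearMap.ker (F.χ.bearingRigidityMatrix F.G).mulVecLin =
    LinearMap.ker (F.χ.bearingRigidityMatrix F.G.complete).mulVecLin

end Framework

end BearingRigidity

end

/-! Every edge of `G` is an edge of the complete graph `K`, so `ker B_K ≤ ker B_G`, and by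
rank-nullity IBR means that the two ranks agree (`isIBR_iff_rank_eq`). It remains to show `rank B_K
= cn - c - 1`. An edge `(i, j)` constrains a motion by `w_j - w_i = l • p_ij + ω_i × p_ij` with a
free scalar `l` (`edge_equation_iff`). Over all pairs of distinct, non-collinear positions, closing
up triangles forces a common `l` and a common `ω` (`triangle_rigid`,
`exists_similarity_of_complete`). Hence `ker B_K` consists of the motions whose velocities come from
a translation, a dilation and a joint rotation, a family of dimension `c + 1`. The `6n` coordinates
contain uncontrollable ones, killed by `idBlock` or `V`. Passing to velocities, a space of dimension
`cn`, removes them, and the rank is `cn - (c + 1)`. -/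

noncomputable section

namespace BearingRigidity
-- Incidence matrices and edges of the complete graph.
namespace SensingGraph
theorem blockDiag_mulVec {n : ℕ} (G : SensingGraph n) (M : G.edges → Matrix (Fin 3) (Fin 3) ℝ)
    (v : G.edges × Fin 3 → ℝ) (k : G.edges) (a : Fin 3) :
    (G.blockDiag M *ᵥ v) (k, a) = (M k *ᵥ fun b => v (k, b)) a := by
  simp [blockDiag, Matrix.mulVec, dotProduct, Matrix.blockDiagonal_apply, Fintype.sum_prod_type]

theorem incidenceBar_transpose_mulVec {n : ℕ} (G : SensingGraph n) (v : Fin n × Fin 3 → ℝ)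
    (k : G.edges) (a : Fin 3) :
    (G.incidenceBarᵀ *ᵥ v) (k, a) = v (k.1.2, a) - v (k.1.1, a) := by
  have hk : k.1.1 ≠ k.1.2 := G.irrefl _ _ k.2
  have h : ∀ i, (if k.1.1 = i then -1 else if k.1.2 = i then (1:ℝ) else 0) =
      (if k.1.2 = i then 1 else 0) - (if k.1.1 = i then 1 else 0) := by
    intro i; split_ifs <;> simp_all
  simp [incidenceBar, incidence, Matrix.mulVec, dotProduct, Fintype.sum_prod_type,
    Matrix.kroneckerMap_apply, Matrix.one_apply, h, sub_mul, Finset.sum_sub_distrib]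

theorem incidenceOutBar_transpose_mulVec {n : ℕ} (G : SensingGraph n) (v : Fin n × Fin 3 → ℝ)
    (k : G.edges) (a : Fin 3) :
    (G.incidenceOutBarᵀ *ᵥ v) (k, a) = - v (k.1.1, a) := by
  simp [incidenceOutBar, incidenceOut, Matrix.mulVec, dotProduct, Fintype.sum_prod_type,
    Matrix.kroneckerMap_apply, Matrix.one_apply]

theorem edges_subset_complete {n : ℕ} (G : SensingGraph n) : G.edges ⊆ G.complete.edges := by
  rintro ⟨i, j⟩ h
  simp [complete, h, G.irrefl i j h]

theorem mem_complete_of_directed {n : ℕ} {G : SensingGraph n} (h : G.directed = true)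
    {i j : Fin n} (hij : i ≠ j) : (i, j) ∈ G.complete.edges := by
  simp [complete, h, hij]

theorem mem_complete_or {n : ℕ} (G : SensingGraph n) {i j : Fin n} (hij : i ≠ j) :
    (i, j) ∈ G.complete.edges ∨ (j, i) ∈ G.complete.edges := by
  by_cases h1 : (i, j) ∈ G.edges
  · exact Or.inl (G.edges_subset_complete h1)
  by_cases h2 : (j, i) ∈ G.edges
  · exact Or.inr (G.edges_subset_complete h2)
  rcases lt_or_gt_of_ne hij with h | h
  · left; simp [complete, h1, h2, hij, h]
  · right; simp [complete, h1, h2, hij.symm, h]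

end SensingGraph

/-! ### Cross products and linear independence in `ℝ³`. -/

theorem skew_mulVec (x y : Fin 3 → ℝ) : skew x *ᵥ y = crossProduct x y := by
  simp [skew, LinearMap.toMatrix'_mulVec]

theorem enorm3_ne_zero {x : Fin 3 → ℝ} (hx : x ≠ 0) : enorm3 x ≠ 0 := by
  have : 0 < x ⬝ᵥ x := by
    refine lt_of_le_of_ne (by simpa using dotProduct_star_self_nonneg x) fun h => hx ?_
    simpa using h.symm
  exact (Real.sqrt_pos.2 this).ne'

theorem enorm3_mul_self (x : Fin 3 → ℝ) : enorm3 x * enorm3 x = x ⬝ᵥ x :=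
  Real.mul_self_sqrt (by simpa using dotProduct_star_self_nonneg x)

theorem eq_zero_of_smul_add_smul_eq_zero {x y : Fin 3 → ℝ} (h : crossProduct x y ≠ 0)
    {a b : ℝ} (e : a • x + b • y = 0) : a = 0 ∧ b = 0 := by
  have ha : crossProduct (a • x + b • y) y = a • crossProduct x y := by
    rw [map_add, map_smul, map_smul, LinearMap.add_apply, LinearMap.smul_apply,
      LinearMap.smul_apply, cross_self, smul_zero, add_zero]
  have hb : crossProduct x (a • x + b • y) = b • crossProduct x y := by
    rw [map_add, map_smul, map_smul, cross_self, smul_zero, zero_add]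
  rw [e, map_zero, LinearMap.zero_apply, eq_comm, smul_eq_zero] at ha
  rw [e, map_zero, eq_comm, smul_eq_zero] at hb
  exact ⟨ha.resolve_right h, hb.resolve_right h⟩

theorem eq_zero_of_smul_add_smul_add_smul_cross_eq_zero {x y : Fin 3 → ℝ}
    (h : crossProduct x y ≠ 0) {a b c : ℝ} (e : a • x + b • y + c • crossProduct x y = 0) :
    a = 0 ∧ b = 0 ∧ c = 0 := by
  have hc : c = 0 := by
    have h1 : crossProduct x y ⬝ᵥ (a • x + b • y + c • crossProduct x y) = 0 := by
      rw [e, dotProduct_zero]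
    have h2 : crossProduct x y ⬝ᵥ x = 0 := by rw [dotProduct_comm, dot_self_cross]
    have h3 : crossProduct x y ⬝ᵥ y = 0 := by rw [dotProduct_comm, dot_cross_self]
    rw [dotProduct_add, dotProduct_add, dotProduct_smul, dotProduct_smul, dotProduct_smul, h2, h3,
      smul_zero, smul_zero, zero_add, zero_add, smul_eq_mul, mul_eq_zero] at h1
    exact h1.resolve_right (mt dotProduct_self_eq_zero.1 h)
  subst hc
  have := eq_zero_of_smul_add_smul_eq_zero h (a := a) (b := b) (by simpa using e)
  exact ⟨this.1, this.2, rfl⟩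

theorem exists_smul_of_cross_eq_zero {x y : Fin 3 → ℝ} (hx : x ≠ 0) (h : crossProduct x y = 0) :
    ∃ r : ℝ, y = r • x := by
  by_contra hr
  push Not at hr
  refine crossProduct_ne_zero_iff_linearIndependent.2 ?_ h
  rw [LinearIndependent.pair_iff' hx]
  exact fun a => (hr a).symm


/-! ### Rigidity of triangles and of complete frameworks. -/

section Triangle

variable {ι : Type*} {p w ω : ι → Fin 3 → ℝ}

theorem exists_cross_ne_zero_of_not_collinear (hp : Function.Injective p)
    (hc : ¬ Collinear ℝ (Set.range p)) {i j : ι} (hij : i ≠ j) :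
    ∃ k, crossProduct (p j - p i) (p k - p i) ≠ 0 := by
  by_contra h
  push Not at h
  refine hc ((collinear_iff_of_mem (Set.mem_range_self i)).2 ⟨p j - p i, ?_⟩)
  rintro _ ⟨k, rfl⟩
  obtain ⟨r, hr⟩ := exists_smul_of_cross_eq_zero (sub_ne_zero.2 (hp.ne hij.symm)) (h k)
  exact ⟨r, by rw [vadd_eq_add, ← hr, sub_add_cancel]⟩

/-- Adding the two equations leaves a multiple of `y - x` plus a cross product orthogonal to it, so
both terms vanish. -/
theorem symm_and_parallel_of_edge_pair {x y ωx ωy wx wy : Fin 3 → ℝ} (hxy : y - x ≠ 0) {l l' : ℝ}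
    (h : wy - wx = l • (y - x) + crossProduct ωx (y - x))
    (h' : wx - wy = l' • (x - y) + crossProduct ωy (x - y)) :
    l = l' ∧ ∃ a : ℝ, ωy - ωx = a • (y - x) := by
  have e : (l - l') • (y - x) + crossProduct (y - x) (ωy - ωx) = 0 := by
    have : (l • (y - x) + crossProduct ωx (y - x)) +
        (l' • (x - y) + crossProduct ωy (x - y)) = 0 := by
      rw [← h, ← h']; abel
    rw [← this, ← neg_sub y x, ← cross_anticomm (ωy - ωx) (y - x)]
    simp only [map_neg, map_sub, LinearMap.sub_apply]
    module
  have hl : l - l' = 0 := by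
    have h1 : (y - x) ⬝ᵥ ((l - l') • (y - x) + crossProduct (y - x) (ωy - ωx)) = 0 := by
      rw [e, dotProduct_zero]
    rw [dotProduct_add, dot_self_cross, add_zero, dotProduct_smul, smul_eq_mul, mul_eq_zero] at h1
    exact h1.resolve_right (mt dotProduct_self_eq_zero.1 hxy)
  rw [hl, zero_smul, zero_add] at e
  exact ⟨sub_eq_zero.1 hl, exists_smul_of_cross_eq_zero hxy e⟩

variable {l : ι → ι → ℝ}

theorem triangle_rigid (h : ∀ i j, i ≠ j → w j - w i = l i j • (p j - p i) +
    crossProduct (ω i) (p j - p i)) {i j k : ι}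
    (hN : crossProduct (p j - p i) (p k - p i) ≠ 0) :
    l i j = l i k ∧ ω i = ω j := by
  have hij : i ≠ j := by rintro rfl; simp at hN
  have hik : i ≠ k := by rintro rfl; simp at hN
  have hjk : j ≠ k := by rintro rfl; simp [cross_self] at hN
  have nij : p j - p i ≠ 0 := by intro h0; simp [h0] at hN
  have nik : p k - p i ≠ 0 := by intro h0; simp [h0] at hN
  have njk : p k - p j ≠ 0 := by
    intro h0; rw [sub_eq_zero.1 h0, cross_self] at hN; exact hN rfl
  obtain ⟨-, a, ha⟩ := symm_and_parallel_of_edge_pair nij (h i j hij) (h j i hij.symm)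
  obtain ⟨-, b, hb⟩ := symm_and_parallel_of_edge_pair nik (h i k hik) (h k i hik.symm)
  obtain ⟨-, c, hc⟩ := symm_and_parallel_of_edge_pair njk (h j k hjk) (h k j hjk.symm)
  have hy : p k - p j = (p k - p i) - (p j - p i) := by abel
  have h1 := h i j hij
  have h2 := h i k hik
  have h3 := h j k hjk
  rw [hy] at hc h3
  generalize p j - p i = x at *
  generalize p k - p i = y at *
  have hωj : ω j = ω i + a • x := by rw [← ha]; abel
  have e2 : (a - c) • x + (c - b) • y + (0 : ℝ) • crossProduct x y = 0 := by
    have : (ω j - ω i) + (ω k - ω j) - (ω k - ω i) = 0 := by abel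
    rw [ha, hb, hc] at this
    rw [← this]; module
  -- Velocity differences sum to zero around the triangle. As `ω j = ω i + a • x`, the only term
  -- normal to its plane is `a • (x × y)`, so this relation gives both `a = 0` and equal scales.
  have e3 : (l i j - l j k) • x + (l j k - l i k) • y + a • crossProduct x y = 0 := by
    have : (w j - w i) + (w k - w j) - (w k - w i) = 0 := by abel
    rw [h1, h2, h3, hωj] at this
    rw [← this]
    simp only [map_sub, map_add, map_smul, LinearMap.add_apply, LinearMap.smul_apply, cross_self]
    module
  obtain ⟨f1, f2, f3⟩ := eq_zero_of_smul_add_smul_add_smul_cross_eq_zero hN e3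
  refine ⟨by linarith, ?_⟩
  rw [hωj, f3]; simp

theorem exists_similarity_of_complete (hp : Function.Injective p)
    (hc : ¬ Collinear ℝ (Set.range p))
    (h : ∀ i j, i ≠ j → ∃ l : ℝ, w j - w i = l • (p j - p i) + crossProduct (ω i) (p j - p i)) :
    ∃ (t : Fin 3 → ℝ) (l : ℝ) (ω₀ : Fin 3 → ℝ),
      ∀ i, w i = t + l • p i + crossProduct ω₀ (p i) ∧ ω i = ω₀ := by
  obtain ⟨i₀⟩ : Nonempty ι := by
    by_contra he
    rw [not_nonempty_iff] at he
    exact hc (by rw [Set.range_eq_empty]; exact collinear_empty ℝ _)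
  choose! l hl using h
  obtain ⟨j₀, hj₀⟩ : ∃ j, i₀ ≠ j := by
    by_contra he
    push Not at he
    refine hc ((collinear_singleton ℝ (p i₀)).subset ?_)
    rintro _ ⟨k, rfl⟩
    simp [he k]
  have hω : ∀ i, ω i = ω i₀ := by
    intro i
    by_cases hi : i₀ = i
    · rw [hi]
    obtain ⟨k, hk⟩ := exists_cross_ne_zero_of_not_collinear hp hc hi
    exact (triangle_rigid hl hk).2.symm
  have hL : ∀ j, i₀ ≠ j → l i₀ j = l i₀ j₀ := by
    intro j hj
    -- If `i₀`, `j`, `j₀` are collinear, the scales are compared through a vertex `k` off their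
    -- line.
    by_cases hN : crossProduct (p j - p i₀) (p j₀ - p i₀) = 0
    · obtain ⟨k, hk⟩ := exists_cross_ne_zero_of_not_collinear hp hc hj
      obtain ⟨r, hr⟩ := exists_smul_of_cross_eq_zero (sub_ne_zero.2 (hp.ne hj.symm)) hN
      have hr0 : r ≠ 0 := by
        rintro rfl
        exact sub_ne_zero.2 (hp.ne hj₀.symm) (by simpa using hr)
      have hk' : crossProduct (p j₀ - p i₀) (p k - p i₀) ≠ 0 := by
        rw [hr, map_smul, LinearMap.smul_apply]
        exact smul_ne_zero hr0 hk
      rw [(triangle_rigid hl hk).1, (triangle_rigid hl hk').1]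
    · exact (triangle_rigid hl hN).1
  refine ⟨w i₀ - l i₀ j₀ • p i₀ - crossProduct (ω i₀) (p i₀), l i₀ j₀, ω i₀, fun i => ⟨?_, hω i⟩⟩
  by_cases hi : i₀ = i
  · subst hi; abel
  have := hl i₀ i hi
  rw [hL i hi, map_sub, sub_eq_iff_eq_add] at this
  rw [this]
  module

end Triangle

/-! ### The translational block and the projector of an agent domain. -/

namespace AgentDomain

variable (D : AgentDomain)

theorem idBlock_mulVec_eq_self {x : Fin 3 → ℝ} (hx : D.d = 2 → x 2 = 0) :
    D.idBlock *ᵥ x = x := by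
  ext a
  rw [idBlock, Matrix.mulVec_diagonal]
  rcases D.d_eq with h | h
  · fin_cases a <;> simp [h, hx h]
  · simp [h, a.2]

theorem dotProduct_idBlock_mulVec (x y : Fin 3 → ℝ) :
    x ⬝ᵥ (D.idBlock *ᵥ y) = (D.idBlock *ᵥ x) ⬝ᵥ y := by
  simp only [idBlock, dotProduct, Matrix.mulVec_diagonal]
  exact Finset.sum_congr rfl fun a _ => by ring

theorem rank_idBlock : D.idBlock.rank = D.d := by
  classical
  rw [idBlock, Matrix.rank_diagonal]
  rcases D.d_eq with h | h
  · rw [h, Fintype.card_subtype]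
    simp [Finset.filter, Fin.univ_succ]
  · rw [h, Fintype.card_subtype]
    simp

/-- In the plane, `V o` is a multiple of `e₃`, so its cross products are horizontal. -/
theorem idBlock_mulVec_cross (o x : Fin 3 → ℝ) :
    D.idBlock *ᵥ crossProduct (D.V *ᵥ o) x = crossProduct (D.V *ᵥ o) x := by
  refine D.idBlock_mulVec_eq_self fun h => ?_
  have := D.planar_axis h
  simp [cross_apply, Matrix.mulVec, dotProduct, this]

theorem proj_mulVec (x y : Fin 3 → ℝ) :
    D.proj x *ᵥ y = D.idBlock *ᵥ y - ((enorm3 x)⁻¹ * (enorm3 x)⁻¹ * (x ⬝ᵥ y)) • x := by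
  rw [proj, Matrix.sub_mulVec, Matrix.vecMulVec_mulVec]
  ext a
  simp
  ring

end AgentDomain


/-! ### The kernel of the rigidity matrix as a system of edge equations. -/

/-- The position part of a vector of infinitesimal motions. -/
def linPart {n : ℕ} (v : (Fin n × Fin 3) ⊕ (Fin n × Fin 3) → ℝ) (i : Fin n) : Fin 3 → ℝ :=
  fun a => v (Sum.inl (i, a))

/-- The orientation part of a vector of infinitesimal motions. -/
def angPart {n : ℕ} (v : (Fin n × Fin 3) ⊕ (Fin n × Fin 3) → ℝ) (i : Fin n) : Fin 3 → ℝ :=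
  fun a => v (Sum.inr (i, a))

namespace Configuration

variable {D : AgentDomain} {n : ℕ} (χ : Configuration D n)

theorem bearingRigidityMatrix_mulVec (G : SensingGraph n)
    (v : (Fin n × Fin 3) ⊕ (Fin n × Fin 3) → ℝ) (k : G.edges) (a : Fin 3) :
    (χ.bearingRigidityMatrix G *ᵥ v) (k, a) =
      ((χ.R k.1.1 : Matrix (Fin 3) (Fin 3) ℝ)ᵀ *ᵥ
        (χ.invDist k.1.1 k.1.2 •
            (D.proj (χ.dir k.1.1 k.1.2) *ᵥ (linPart v k.1.2 - linPart v k.1.1)) +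
          crossProduct (χ.dir k.1.1 k.1.2) (D.V *ᵥ angPart v k.1.1))) a := by
  have h1 : (fun b => (G.incidenceBarᵀ *ᵥ (v ∘ Sum.inl)) (k, b)) =
      linPart v k.1.2 - linPart v k.1.1 := by
    ext b; rw [G.incidenceBar_transpose_mulVec]; rfl
  have h2 : (fun b => (G.incidenceOutBarᵀ *ᵥ (v ∘ Sum.inr)) (k, b)) = -angPart v k.1.1 := by
    ext b; rw [G.incidenceOutBar_transpose_mulVec]; rfl
  rw [bearingRigidityMatrix, Matrix.fromCols_mulVec, Pi.add_apply, ← Matrix.mulVec_mulVec,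
    ← Matrix.mulVec_mulVec, Dp, Do, Matrix.neg_mulVec, Pi.neg_apply, G.blockDiag_mulVec,
    G.blockDiag_mulVec, h1, h2, Matrix.mulVec_neg, Pi.neg_apply, neg_neg, Matrix.mulVec_add,
    Pi.add_apply, ← skew_mulVec, Matrix.mulVec_smul, Matrix.smul_mulVec, Matrix.mulVec_mulVec,
    Matrix.mulVec_mulVec, Matrix.mulVec_mulVec, Matrix.mul_assoc]

theorem transpose_rotation_mulVec_eq_zero (R : SO3) {x : Fin 3 → ℝ} :
    (R : Matrix (Fin 3) (Fin 3) ℝ)ᵀ *ᵥ x = 0 ↔ x = 0 := by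
  refine ⟨fun h => ?_, fun h => by rw [h, Matrix.mulVec_zero]⟩
  have hR : (R : Matrix (Fin 3) (Fin 3) ℝ) * (R : Matrix (Fin 3) (Fin 3) ℝ)ᵀ = 1 :=
    (Matrix.mem_orthogonalGroup_iff (Fin 3) ℝ).1 (Matrix.mem_specialOrthogonalGroup_iff.1 R.2).1
  rw [← Matrix.one_mulVec x, ← hR, ← Matrix.mulVec_mulVec, h, Matrix.mulVec_zero]

theorem mem_ker_iff (G : SensingGraph n) (v : (Fin n × Fin 3) ⊕ (Fin n × Fin 3) → ℝ) :
    v ∈ LinearMap.ker (χ.bearingRigidityMatrix G).mulVecLin ↔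
      ∀ i j, (i, j) ∈ G.edges →
        χ.invDist i j • (D.proj (χ.dir i j) *ᵥ (linPart v j - linPart v i)) +
          crossProduct (χ.dir i j) (D.V *ᵥ angPart v i) = 0 := by
  rw [LinearMap.mem_ker, Matrix.mulVecLin_apply]
  constructor
  · intro h i j hij
    rw [← transpose_rotation_mulVec_eq_zero (χ.R i)]
    ext a
    rw [← χ.bearingRigidityMatrix_mulVec G v ⟨(i, j), hij⟩ a, h]
    rfl
  · intro h
    ext ⟨k, a⟩
    rw [χ.bearingRigidityMatrix_mulVec G v k a, h k.1.1 k.1.2 k.2, Matrix.mulVec_zero]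
    rfl

theorem rel_two (i j : Fin n) (h : D.d = 2) : χ.rel i j 2 = 0 := by
  have hi : χ.p i 2 = 0 := (χ.mem i).1 h
  have hj : χ.p j 2 = 0 := (χ.mem j).1 h
  rw [rel, Pi.sub_apply, hi, hj, sub_zero]

theorem idBlock_mulVec_p (i : Fin n) : D.idBlock *ᵥ χ.p i = χ.p i :=
  D.idBlock_mulVec_eq_self (χ.mem i).1

theorem dir_dotProduct_self {i j : Fin n} (h : χ.rel i j ≠ 0) : χ.dir i j ⬝ᵥ χ.dir i j = 1 := by
  have := enorm3_ne_zero h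
  rw [dir, smul_dotProduct, dotProduct_smul, ← enorm3_mul_self, invDist, smul_eq_mul, smul_eq_mul]
  field_simp

theorem enorm3_dir {i j : Fin n} (h : χ.rel i j ≠ 0) : enorm3 (χ.dir i j) = 1 := by
  rw [enorm3, χ.dir_dotProduct_self h, Real.sqrt_one]

/-- The projector forgets exactly the component along `p_ij`, which becomes the free scalar `l`; the
factor `d_ij ≠ 0` cancels. -/
theorem edge_equation_iff {i j : Fin n} (h : χ.rel i j ≠ 0) (y o : Fin 3 → ℝ) :
    χ.invDist i j • (D.proj (χ.dir i j) *ᵥ y) + crossProduct (χ.dir i j) (D.V *ᵥ o) = 0 ↔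
      ∃ l : ℝ, D.idBlock *ᵥ y = l • χ.rel i j + crossProduct (D.V *ᵥ o) (χ.rel i j) := by
  have hd : χ.invDist i j ≠ 0 := inv_ne_zero (enorm3_ne_zero h)
  have hJ : D.idBlock *ᵥ χ.dir i j = χ.dir i j := by
    rw [dir, Matrix.mulVec_smul, D.idBlock_mulVec_eq_self (χ.rel_two i j)]
  have key : χ.invDist i j • (D.proj (χ.dir i j) *ᵥ y) + crossProduct (χ.dir i j) (D.V *ᵥ o) =
      χ.invDist i j • (D.idBlock *ᵥ y - (χ.dir i j ⬝ᵥ y) • χ.dir i j -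
        crossProduct (D.V *ᵥ o) (χ.rel i j)) := by
    rw [D.proj_mulVec, χ.enorm3_dir h, ← cross_anticomm (D.V *ᵥ o) (χ.dir i j)]
    nth_rewrite 3 [dir]
    rw [map_smul]
    simp only [inv_one, one_mul]
    module
  rw [key, smul_eq_zero, or_iff_right hd, sub_sub, sub_eq_zero]
  constructor
  · intro e
    exact ⟨(χ.dir i j ⬝ᵥ y) * χ.invDist i j, by rw [e, dir, smul_smul]⟩
  · rintro ⟨l, e⟩
    -- Pairing with the unit direction kills the cross product and determines `l`; `idBlock` is
    -- symmetric and fixes this direction.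
    have e1 : χ.dir i j ⬝ᵥ y = l * (χ.invDist i j)⁻¹ := by
      have hr : χ.rel i j = (χ.invDist i j)⁻¹ • χ.dir i j := by
        rw [dir, smul_smul, inv_mul_cancel₀ hd, one_smul]
      rw [← hJ, ← D.dotProduct_idBlock_mulVec, e, hr, map_smul, dotProduct_add, dotProduct_smul,
        dotProduct_smul, dotProduct_smul, χ.dir_dotProduct_self h, dot_cross_self]
      simp
    rw [e, e1, dir, smul_smul, mul_assoc, inv_mul_cancel₀ hd, mul_one]

end Configuration

/-! ### The kernel for the complete graph. -/

namespace Framework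

variable {D : AgentDomain} {n : ℕ} (F : Framework D n)

theorem mem_ker_complete_iff (hF : F.NonDegenerate)
    (v : (Fin n × Fin 3) ⊕ (Fin n × Fin 3) → ℝ) :
    v ∈ LinearMap.ker (F.χ.bearingRigidityMatrix F.G.complete).mulVecLin ↔
      ∃ (t : Fin 3 → ℝ) (l : ℝ) (ω : Fin 3 → ℝ), ∀ i,
        D.idBlock *ᵥ linPart v i = t + l • F.χ.p i + crossProduct ω (F.χ.p i) ∧
          D.V *ᵥ angPart v i = ω := by
  have hrel : ∀ i j, i ≠ j → F.χ.rel i j ≠ 0 := fun i j hij => sub_ne_zero.2 (hF.2.ne hij.symm)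
  rw [Configuration.mem_ker_iff]
  constructor
  · intro h
    refine exists_similarity_of_complete hF.2 hF.1 fun i j hij => ?_
    have h' : ∀ i j, (i, j) ∈ F.G.complete.edges → ∃ l : ℝ,
        D.idBlock *ᵥ linPart v j - D.idBlock *ᵥ linPart v i =
          l • F.χ.rel i j + crossProduct (D.V *ᵥ angPart v i) (F.χ.rel i j) := by
      intro i j hij
      rw [← Matrix.mulVec_sub]
      exact (F.χ.edge_equation_iff (hrel i j (F.G.complete.irrefl i j hij)) _ _).1 (h i j hij)
    -- Without rotations an edge equation is unchanged by reversal, so one orientation suffices.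
    -- Otherwise the graph is directed and has both edges.
    by_cases hV : D.V = 0
    · rcases F.G.mem_complete_or hij with he | he
      · exact h' i j he
      · obtain ⟨l, hl⟩ := h' j i he
        refine ⟨l, ?_⟩
        simp only [hV, Matrix.zero_mulVec, map_zero, LinearMap.zero_apply, add_zero] at hl ⊢
        rw [← neg_sub, hl, Configuration.rel]
        module
    · exact h' i j (SensingGraph.mem_complete_of_directed (F.directed_of_rotating hV) hij)
  · rintro ⟨t, l, ω, h⟩ i j hij
    rw [F.χ.edge_equation_iff (hrel i j (F.G.complete.irrefl i j hij))]
    refine ⟨l, ?_⟩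
    rw [Matrix.mulVec_sub, (h i).1, (h j).1, (h i).2, Configuration.rel, map_sub]
    module

theorem ker_complete_le :
    LinearMap.ker (F.χ.bearingRigidityMatrix F.G.complete).mulVecLin ≤
      LinearMap.ker (F.χ.bearingRigidityMatrix F.G).mulVecLin := by
  intro v hv
  rw [Configuration.mem_ker_iff] at hv ⊢
  exact fun i j hij => hv i j (F.G.edges_subset_complete hij)

end Framework

/-! ### Dimensions of the velocities and of the trivial motions. -/

/-- The controllable part of an infinitesimal motion: the velocities of all agents. -/
abbrev Velocities (D : AgentDomain) (n : ℕ) : Type :=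
  (Fin n → LinearMap.range D.idBlock.mulVecLin) × (Fin n → LinearMap.range D.V.mulVecLin)

/-- The parameters of the trivial motions: a translation, a dilation and a rotation. -/
abbrev TrivialMotions (D : AgentDomain) : Type :=
  LinearMap.range D.idBlock.mulVecLin × ℝ × LinearMap.range D.V.mulVecLin

theorem finrank_velocities (D : AgentDomain) (n : ℕ) :
    Module.finrank ℝ (Velocities D n) = n * D.dofs := by
  have h1 : Module.finrank ℝ (LinearMap.range D.idBlock.mulVecLin) = D.d := D.rank_idBlock
  have h2 : Module.finrank ℝ (LinearMap.range D.V.mulVecLin) = D.V.rank := rfl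
  rw [Module.finrank_prod, Module.finrank_pi_fintype, Module.finrank_pi_fintype, h1, h2]
  simp [AgentDomain.dofs, mul_add]

theorem finrank_trivialMotions (D : AgentDomain) :
    Module.finrank ℝ (TrivialMotions D) = D.dofs + 1 := by
  have h1 : Module.finrank ℝ (LinearMap.range D.idBlock.mulVecLin) = D.d := D.rank_idBlock
  have h2 : Module.finrank ℝ (LinearMap.range D.V.mulVecLin) = D.V.rank := rfl
  rw [Module.finrank_prod, Module.finrank_prod, h1, h2, Module.finrank_self, AgentDomain.dofs]
  ring

/-- The velocities induced by a vector of infinitesimal motions. -/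
def toVelocities (D : AgentDomain) (n : ℕ) :
    ((Fin n × Fin 3) ⊕ (Fin n × Fin 3) → ℝ) →ₗ[ℝ] Velocities D n where
  toFun v := (fun i => D.idBlock.mulVecLin.rangeRestrict (linPart v i),
    fun i => D.V.mulVecLin.rangeRestrict (angPart v i))
  map_add' v v' := by
    refine Prod.ext (funext fun i => ?_) (funext fun i => ?_)
    · exact map_add D.idBlock.mulVecLin.rangeRestrict (linPart v i) (linPart v' i)
    · exact map_add D.V.mulVecLin.rangeRestrict (angPart v i) (angPart v' i)
  map_smul' r v := by
    refine Prod.ext (funext fun i => ?_) (funext fun i => ?_)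
    · exact map_smul D.idBlock.mulVecLin.rangeRestrict r (linPart v i)
    · exact map_smul D.V.mulVecLin.rangeRestrict r (angPart v i)

theorem toVelocities_surjective (D : AgentDomain) (n : ℕ) :
    Function.Surjective (toVelocities D n) := by
  rintro ⟨x, y⟩
  choose u hu using fun i => LinearMap.surjective_rangeRestrict D.idBlock.mulVecLin (x i)
  choose o ho using fun i => LinearMap.surjective_rangeRestrict D.V.mulVecLin (y i)
  exact ⟨Sum.elim (fun k => u k.1 k.2) (fun k => o k.1 k.2),
    Prod.ext (funext hu) (funext ho)⟩

namespace Configuration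

variable {D : AgentDomain} {n : ℕ} (χ : Configuration D n)

theorem trivial_velocity_mem (z : TrivialMotions D) (i : Fin n) :
    (z.1 : Fin 3 → ℝ) + z.2.1 • χ.p i + crossProduct (z.2.2 : Fin 3 → ℝ) (χ.p i) ∈
      LinearMap.range D.idBlock.mulVecLin := by
  obtain ⟨t, l, ω, o, rfl⟩ := z
  refine add_mem (add_mem t.2 (Submodule.smul_mem _ _ ⟨χ.p i, χ.idBlock_mulVec_p i⟩)) ?_
  exact ⟨_, D.idBlock_mulVec_cross o (χ.p i)⟩

/-- The velocities of the agents under a trivial motion. -/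
def trivialVelocities : TrivialMotions D →ₗ[ℝ] Velocities D n where
  toFun z := (fun i => ⟨_, χ.trivial_velocity_mem z i⟩, fun _ => z.2.2)
  map_add' z z' := by
    refine Prod.ext (funext fun i => Subtype.ext ?_) rfl
    simp only [Prod.fst_add, Prod.snd_add, Pi.add_apply, Submodule.coe_add, map_add,
      LinearMap.add_apply]
    module
  map_smul' r z := by
    refine Prod.ext (funext fun i => Subtype.ext ?_) rfl
    simp only [Prod.smul_fst, Prod.smul_snd, Pi.smul_apply, Submodule.coe_smul, map_smul,
      LinearMap.smul_apply, smul_eq_mul, RingHom.id_apply]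
    module

theorem trivialVelocities_injective (hp : Function.Injective χ.p) (hn : 2 ≤ n) :
    Function.Injective χ.trivialVelocities := by
  rw [injective_iff_map_eq_zero]
  rintro ⟨⟨t, ht⟩, l, ⟨ω, hω⟩⟩ h
  have i₀ : Fin n := ⟨0, by omega⟩
  have h2 : ω = 0 := congrArg Subtype.val (congrFun (congrArg Prod.snd h) i₀)
  have h1 : ∀ i, t + l • χ.p i = 0 := by
    intro i
    have : t + l • χ.p i + crossProduct ω (χ.p i) = 0 :=
      congrArg Subtype.val (congrFun (congrArg Prod.fst h) i)
    simpa [h2] using this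
  -- Two distinct positions separate dilation from translation.
  have hl : l = 0 := by
    have e0 := h1 ⟨0, by omega⟩
    have e1 := h1 ⟨1, by omega⟩
    have e : l • (χ.p ⟨1, by omega⟩ - χ.p ⟨0, by omega⟩) = 0 := by
      rw [smul_sub, sub_eq_zero]; exact add_left_cancel (e1.trans e0.symm)
    refine (smul_eq_zero.1 e).resolve_right (sub_ne_zero.2 (hp.ne ?_))
    simp
  have h3 : t = 0 := by simpa [hl] using h1 i₀
  subst hl h2 h3
  rfl

end Configuration

/-- Linear maps with the same kernel have the same rank. -/
theorem finrank_range_eq_of_ker_eq {K E F₁ F₂ : Type*} [DivisionRing K] [AddCommGroup E]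
    [Module K E] [FiniteDimensional K E] [AddCommGroup F₁] [Module K F₁] [AddCommGroup F₂]
    [Module K F₂] {f : E →ₗ[K] F₁} {g : E →ₗ[K] F₂} (h : LinearMap.ker f = LinearMap.ker g) :
    Module.finrank K (LinearMap.range f) = Module.finrank K (LinearMap.range g) := by
  have h1 := f.finrank_range_add_finrank_ker
  have h2 := g.finrank_range_add_finrank_ker
  rw [h] at h1
  omega

/-! ### The rank for the complete graph and the rank criterion. -/

namespace Framework

variable {D : AgentDomain} {n : ℕ} (F : Framework D n)

/-- The map on the right is onto the quotient of velocities by trivial ones. Since the kernel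
determines the rank, the rank of `B_K` is the dimension of that quotient. -/
theorem ker_complete_eq (hF : F.NonDegenerate) (hn : 0 < n) :
    LinearMap.ker (F.χ.bearingRigidityMatrix F.G.complete).mulVecLin =
      LinearMap.ker
        ((LinearMap.range F.χ.trivialVelocities).mkQ ∘ₗ toVelocities D n) := by
  ext v
  rw [F.mem_ker_complete_iff hF, LinearMap.ker_comp, Submodule.ker_mkQ, Submodule.mem_comap]
  constructor
  · rintro ⟨t, l, ω, h⟩
    have hω : ω ∈ LinearMap.range D.V.mulVecLin := ⟨_, (h ⟨0, hn⟩).2⟩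
    -- The translation is the velocity of one agent minus its dilation and rotation parts, all of
    -- which lie in `ℝᵈ`.
    have ht : t ∈ LinearMap.range D.idBlock.mulVecLin := by
      have h0 := F.χ.trivial_velocity_mem ⟨0, l, ⟨ω, hω⟩⟩ ⟨0, hn⟩
      have h1 : t + l • F.χ.p ⟨0, hn⟩ + crossProduct ω (F.χ.p ⟨0, hn⟩) ∈
          LinearMap.range D.idBlock.mulVecLin := ⟨_, (h ⟨0, hn⟩).1⟩
      convert sub_mem h1 h0 using 1
      simp only [ZeroMemClass.coe_zero]
      module
    refine ⟨⟨⟨t, ht⟩, l, ⟨ω, hω⟩⟩, Prod.ext (funext fun i => Subtype.ext ?_)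
      (funext fun i => Subtype.ext ?_)⟩
    · exact (h i).1.symm
    · exact (h i).2.symm
  · rintro ⟨⟨t, l, ω⟩, h⟩
    refine ⟨t, l, ω, fun i => ⟨?_, ?_⟩⟩
    · exact (congrArg Subtype.val (congrFun (congrArg Prod.fst h) i)).symm
    · exact (congrArg Subtype.val (congrFun (congrArg Prod.snd h) i)).symm

theorem rank_complete (hF : F.NonDegenerate) (hn : 2 ≤ n) :
    (F.χ.bearingRigidityMatrix F.G.complete).rank + (D.dofs + 1) = n * D.dofs := by
  have hs : LinearMap.range
      ((LinearMap.range F.χ.trivialVelocities).mkQ ∘ₗ toVelocities D n) = ⊤ :=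
    LinearMap.range_eq_top.2 ((Submodule.mkQ_surjective _).comp (toVelocities_surjective D n))
  rw [Matrix.rank, finrank_range_eq_of_ker_eq (F.ker_complete_eq hF (by omega)), hs, finrank_top,
    ← finrank_trivialMotions D,
    ← LinearMap.finrank_range_of_inj (F.χ.trivialVelocities_injective hF.2 hn),
    Submodule.finrank_quotient_add_finrank, finrank_velocities]

theorem isIBR_iff_rank_eq :
    F.IsIBR ↔ (F.χ.bearingRigidityMatrix F.G).rank =
      (F.χ.bearingRigidityMatrix F.G.complete).rank := by
  refine ⟨fun h => finrank_range_eq_of_ker_eq h, fun h => ?_⟩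
  refine (Submodule.eq_of_le_of_finrank_eq F.ker_complete_le ?_).symm
  have h1 := (F.χ.bearingRigidityMatrix F.G).mulVecLin.finrank_range_add_finrank_ker
  have h2 := (F.χ.bearingRigidityMatrix F.G.complete).mulVecLin.finrank_range_add_finrank_ker
  rw [Matrix.rank, Matrix.rank] at h
  omega

end Framework

end BearingRigidity

end

theorem mainTheorem1 (D : BearingRigidity.AgentDomain) (n : ℕ) (hn : 3 ≤ n)
    (F : BearingRigidity.Framework D n) (hF : F.NonDegenerate) :
    F.IsIBR ↔
      ((F.χ.bearingRigidityMatrix F.G).rank : ℤ) = (D.dofs : ℤ) * n - D.dofs - 1 := by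
  have h := F.rank_complete hF (by omega)
  rw [F.isIBR_iff_rank_eq]
  -- `rank_complete` is additive in `ℕ`; over `ℤ` it can be solved for the rank without truncated
  -- subtraction.
  zify at h ⊢
  constructor <;> intro h' <;> linarith
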